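/- Let $\mathbb{K}=\mathbb{R}$ or $\mathbb{K}=\mathbb{C}$, and let $E,A\in\mathbb{K}^{n\times n}$, $B\in\mathbb{K}^{n\times m}$, $C\in\mathbb{K}^{m\times n}$, $D\in\mathbb{K}^{m\times m}$ describe the input-output descriptor system $E\dot x=Ax+B(u+w)$, $y=Cx+D(u+w)$. Assume that the pair $(E,A)$ is regular, i.e. $\det(sE-A)$ is not identically zero, and that the matrices $\begin{bmatrix}E & B\end{bmatrix}$ and $\begin{bmatrix}E\\ C\end{bmatrix}$ have maximum rank. Let $G(s)=C(sE-A)^{-1}B+D$ be the transfer function of the system, and put $$\mathcal{E}=\begin{bmatrix}E&0\\0&0\end{bmatrix},\qquad \mathcal{A}=\begin{bmatrix}A&B\\C&D\end{bmatrix}.$$ A number $\lambda\in\mathbb{C}$ is an eigenvalue of a pair $(E,A_c)$ if $(\lambda E-A_c)v=0$ for some non-zero $v \in \mathbb{C}^n$; the pair is stable if all its eigenvalues have negative real part. A square rational matrix function $H$ is strictly positive real (SPR) if there is $\epsilon>0$ such that the Hermitian matrix $H(s)+H(s)^{*}$ is positive definite for every $s\in\mathbb{C}$ with $\Re(s)\ge-\epsilon$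 that is not a pole of $H$, where $s$ is a pole of $H$ if $\lim_{s'\to s}H(s')$ does not exist. The index of zero as an eigenvalue of a square matrix $S$ is the smallest integer $k\ge0$ for which $S^{k+1}$ and $S^{k}$ have the same rank. Then there exist matrices $K,L\in\mathbb{K}^{m\times m}$ such that $I-KD$ is non-singular, the pair $\bigl(E,\;A+B(I-KD)^{-1}KC\bigr)$ is stable, and $L(I-GK)^{-1}G$ is SPR, if and only if the following two conditions hold: (a) $\mathcal{A}$ is non-singular and the non-zero (complex) eigenvalues of $\mathcal{A}^{-1}\mathcal{E}$ have negative real part; (b) the index of zero as an eigenvalue of $\mathcal{A}^{-1}\mathcal{E}$ is at most two. -/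

import Mathlib

open Filter Topology Matrix
open scoped ComplexOrder

namespace DescriptorSystem

noncomputable section

/-- A matrix over `𝕜 = ℝ` or `𝕜 = ℂ`, regarded as a complex matrix
(entrywise `x ↦ re x + i im x`, i.e. the inclusion `ℝ ⊆ ℂ`, or the identity of `ℂ`). -/
def toComplex {𝕜 ι κ : Type*} [RCLike 𝕜] (M : Matrix ι κ 𝕜) : Matrix ι κ ℂ :=
  M.map (RCLike.map 𝕜 ℂ)

/-- A matrix has maximum rank: its rank is the smaller one of the numbers of rows and columns. -/
def HasMaxRank {𝕜 ι κ : Type*} [Field 𝕜] [Fintype ι] [Fintype κ] (M : Matrix ι κ 𝕜) : Prop :=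
  M.rank = min (Fintype.card ι) (Fintype.card κ)

/-- The block matrix `ℰ = [[E, 0], [0, 0]]`. -/
def bigE {𝕜 ι : Type*} [Field 𝕜] (κ : Type*) (E : Matrix ι ι 𝕜) : Matrix (ι ⊕ κ) (ι ⊕ κ) 𝕜 :=
  Matrix.fromBlocks E 0 0 0

/-- The block matrix `𝒜 = [[A, B], [C, D]]`. -/
def bigA {𝕜 ι κ : Type*} [Field 𝕜] (A : Matrix ι ι 𝕜) (B : Matrix ι κ 𝕜) (C : Matrix κ ι 𝕜)
    (D : Matrix κ κ 𝕜) : Matrix (ι ⊕ κ) (ι ⊕ κ) 𝕜 :=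
  Matrix.fromBlocks A B C D

variable {ι κ : Type*} [Fintype ι] [DecidableEq ι] [Fintype κ] [DecidableEq κ]

/-- The pair `(E, A)` is regular: `det (sE - A)` is not identically zero. -/
def IsRegularPair (E A : Matrix ι ι ℂ) : Prop :=
  ∃ s : ℂ, (s • E - A).det ≠ 0

/-- `lam` is an eigenvalue of the pair `(E, A)`: `(lam E - A) v = 0` for some `v ≠ 0`. -/
def IsPairEigenvalue (E A : Matrix ι ι ℂ) (lam : ℂ) : Prop :=
  ∃ v : ι → ℂ, v ≠ 0 ∧ (lam • E - A) *ᵥ v = 0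

/-- The pair `(E, A)` is stable: all its eigenvalues have negative real part. -/
def IsStablePair (E A : Matrix ι ι ℂ) : Prop :=
  ∀ lam : ℂ, IsPairEigenvalue E A lam → lam.re < 0

/-- The transfer function `G(s) = C (sE - A)⁻¹ B + D`. The formula gives the value of the rational
function `G` at all `s` that are not eigenvalues of `(E, A)`. -/
def transferFunction (E A : Matrix ι ι ℂ) (B : Matrix ι κ ℂ) (C : Matrix κ ι ℂ)
    (D : Matrix κ κ ℂ) (s : ℂ) : Matrix κ κ ℂ :=
  C * (s • E - A)⁻¹ * B + D

/-- The closed-loop transfer function `G_c = L (I - G K)⁻¹ G` for `u = K y`, `z = L y`. -/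
def closedLoopTransfer (G : ℂ → Matrix κ κ ℂ) (K L : Matrix κ κ ℂ) (s : ℂ) : Matrix κ κ ℂ :=
  L * (1 - G s * K)⁻¹ * G s

/-- `H` is strictly positive real: there is `ε > 0` such that `H(s) + H(s)ᴴ > 0` for all `s` with
`re s ≥ -ε` that are not poles of `H`. A point `s` is not a pole when `H` has a limit `M` at `s`
along `s' → s`, `s' ≠ s`; this limit is then the value at `s` of the rational function `H`
(it differs from what the formula for `H` gives at `s` only if `s` is a removable singularity). -/
def IsSPR (H : ℂ → Matrix κ κ ℂ) : Prop :=
  ∃ ε : ℝ, 0 < ε ∧ ∀ (s : ℂ) (M : Matrix κ κ ℂ), -ε ≤ s.re →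
    Tendsto H (𝓝[≠] s) (𝓝 M) → (M + Mᴴ).PosDef

/-- The index of zero as an eigenvalue of the square matrix `S`: the smallest `k ≥ 0` for which
`S ^ (k + 1)` and `S ^ k` have the same rank (zero if `S` is nonsingular). -/
def zeroIndex {𝕜 : Type*} [Field 𝕜] (S : Matrix ι ι 𝕜) : ℕ :=
  sInf {k : ℕ | (S ^ (k + 1)).rank = (S ^ k).rank}

end

end DescriptorSystem

/-!
Everything is read off from the inverse of the system pencil `s ℰ - 𝒜`. Minus its lower right block
is `N(s) = G(s)⁻¹`, and if `M` is the closed-loop transfer function `L (1 - G K)⁻¹ G`, then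
`M (N - K) = L` (`closedLoopValue_mul`): feedback acts on `N` simply by subtracting a constant. Now
`M + Mᴴ > 0` is, apart from a congruence, a condition on `N - K`, namely that `Lᴴ (N - K)` have
positive Hermitian part.

With `S = 𝒜⁻¹ ℰ` one has `s ℰ - 𝒜 = -𝒜 (1 - s S)`. A Drazin inverse of `S` splits `(1 - s S)⁻¹`
into a polynomial of degree one less than the index of zero and a part that vanishes at infinity
and has its poles at the reciprocals of the non-zero eigenvalues of `S`
(`IsDrazin.mul_one_sub_smul`, `inverseTransfer_eq`).

If the index is at most two and the eigenvalues lie in the left half plane, then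
`N(s) = s P + W(s)` with `W` bounded on a half plane `re s ≥ -ε`. Some nonsingular `Z` makes `P Z`
positive semidefinite (`exists_mul_eq_self_mul_conjTranspose`), and `L = Z⁻¹`, `K = -k Z⁻¹` with
large `k` is a feedback as required (`exists_feedback`).

Conversely, closed-loop stability makes `M` finite and `M + Mᴴ > 0` on `re s ≥ 0`, so that
`s ℰ - 𝒜` is nonsingular there (`det_systemPencil_ne_zero`), which is condition (a). The positivity
of `Lᴴ (N - K)` forces `N` to grow at most linearly (`natDegree_le_one_of_re_nonneg`). The whole of
`(s ℰ - 𝒜)⁻¹` then grows at most linearly too, because the rank conditions on `[E B]` and `[E; C]`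
rule out a higher power of `s` whose coefficient vanishes in the lower right block
(`pow_mul_eq_zero_descent`). This is condition (b).
-/

namespace DescriptorSystem

/-! ### Spectral splitting of a singular square matrix -/

section Drazin

variable {F ι : Type*} [Field F] [Fintype ι] [DecidableEq ι]

/-- `X` is a Drazin inverse of `S`, with spectral projection `J = S X = X S`: the range of `J` is
the part of the space on which `S` is bijective with inverse `X`, and on the range of `1 - J`,
where `X` vanishes, the power `S ^ ν` is zero. The number `ν` need not be the smallest possible
one. -/
structure IsDrazin (S J X : Matrix ι ι F) (ν : ℕ) : Prop where
  comm : S * J = J * S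
  idem : J * J = J
  mul_inv : S * X = J
  inv_mul : X * S = J
  proj_mul : J * X = X
  mul_proj : X * J = X
  nilpotent : S ^ ν * (1 - J) = 0

/-- Drazin inverses exist. Both `X` and `J` are polynomials in `S`, obtained from a Bézout relation
between the power of the variable and the remaining factor of the characteristic polynomial. -/
theorem exists_isDrazin (S : Matrix ι ι F) : ∃ (J X : Matrix ι ι F) (ν : ℕ), IsDrazin S J X ν := by
  obtain ⟨q, hpq, hq⟩ := Polynomial.exists_eq_pow_rootMultiplicity_mul_and_not_dvd S.charpoly
    S.charpoly_monic.ne_zero 0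
  set a := Polynomial.rootMultiplicity 0 S.charpoly
  rw [Polynomial.C_0, sub_zero] at hpq hq
  have hcop : IsCoprime (Polynomial.X ^ (a + 1)) q :=
    ((Polynomial.irreducible_X.coprime_iff_not_dvd).2 hq).pow_left
  obtain ⟨u, v, huv⟩ := hcop
  have hSq : S ^ a * Polynomial.aeval S q = 0 := by
    have h := S.aeval_self_charpoly
    rw [hpq] at h
    simpa using h
  set U := Polynomial.aeval S u with hU
  set V := Polynomial.aeval S v
  set Q := Polynomial.aeval S q
  have hSU : S * U = U * S := by
    have : Polynomial.aeval S (Polynomial.X * u) = Polynomial.aeval S (u * Polynomial.X) := by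
      rw [mul_comm]
    simpa using this
  have hSV : S * V = V * S := by
    have : Polynomial.aeval S (Polynomial.X * v) = Polynomial.aeval S (v * Polynomial.X) := by
      rw [mul_comm]
    simpa using this
  have hone : U * S ^ (a + 1) + V * Q = 1 := by
    have := congrArg (Polynomial.aeval S) huv
    simpa using this
  have cSU : Commute S U := hSU
  have cSV : Commute S V := hSV
  set P := U * S ^ (a + 1) with hP
  have hVQ : V * Q = 1 - P := by rw [← hone]; abel
  have cSP : Commute S P := cSU.mul_right (Commute.pow_right (Commute.refl S) _)
  have hnil : S ^ a * (1 - P) = 0 := by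
    rw [← hVQ, ← mul_assoc, (cSV.pow_left a).eq, mul_assoc, hSq, mul_zero]
  have hJJ : P * P = P := by
    have : P * (1 - P) = 0 := by
      have h : P * (1 - P) = U * (S * (S ^ a * (1 - P))) := by
        nth_rw 1 [hP]
        rw [pow_succ', mul_assoc, mul_assoc]
      rw [h, hnil, mul_zero, mul_zero]
    rw [mul_sub, mul_one, sub_eq_zero] at this
    exact this.symm
  set X₀ := U * S ^ a with hX₀
  have h1 : X₀ * S = P := by rw [hX₀, hP, pow_succ, mul_assoc]
  have cSX₀ : Commute S X₀ := cSU.mul_right (Commute.pow_right (Commute.refl S) _)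
  have cPX₀ : Commute P X₀ := by
    rw [← h1]; exact (Commute.refl X₀).mul_left cSX₀
  refine ⟨P, P * X₀, a, cSP.eq, hJJ, ?_, ?_, ?_, ?_, hnil⟩
  · rw [← mul_assoc, cSP.eq, mul_assoc, cSX₀.eq, h1, hJJ]
  · rw [mul_assoc, h1, hJJ]
  · rw [← mul_assoc, hJJ]
  · rw [mul_assoc, ← cPX₀.eq, ← mul_assoc, hJJ]

theorem pow_mul_eq_zero_of_pow_succ_mul_eq_zero {S : Matrix ι ι F} {k : ℕ}
    (h : (S ^ (k + 1)).rank = (S ^ k).rank) {M : Matrix ι ι F} (hM : S ^ (k + 1) * M = 0) :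
    S ^ k * M = 0 := by
  have hle : LinearMap.ker (S ^ k).mulVecLin ≤ LinearMap.ker (S ^ (k + 1)).mulVecLin := by
    intro v hv
    rw [LinearMap.mem_ker, mulVecLin_apply] at hv ⊢
    rw [pow_succ', ← mulVec_mulVec, hv, mulVec_zero]
  have h1 := (S ^ k).mulVecLin.finrank_range_add_finrank_ker
  have h2 := (S ^ (k + 1)).mulVecLin.finrank_range_add_finrank_ker
  unfold Matrix.rank at h
  have heq := Submodule.eq_of_le_of_finrank_eq hle (by omega)
  ext i j
  have hj : (fun i => M i j) ∈ LinearMap.ker (S ^ (k + 1)).mulVecLin := by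
    rw [LinearMap.mem_ker, mulVecLin_apply]
    ext i
    exact congrFun (congrFun hM i) j
  rw [← heq, LinearMap.mem_ker, mulVecLin_apply] at hj
  exact congrFun hj i

theorem pow_mul_eq_zero_of_pow_add_mul_eq_zero {S : Matrix ι ι F} {k : ℕ}
    (h : ∀ M : Matrix ι ι F, S ^ (k + 1) * M = 0 → S ^ k * M = 0) (r : ℕ)
    {M : Matrix ι ι F} (hM : S ^ (k + r) * M = 0) : S ^ k * M = 0 := by
  induction r with
  | zero => exact hM
  | succ r ih =>
    refine ih ?_
    have h1 : S ^ (k + 1) * (S ^ r * M) = 0 := by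
      rw [← mul_assoc, ← pow_add, show k + 1 + r = k + (r + 1) by ring, hM]
    have := h _ h1
    rwa [← mul_assoc, ← pow_add] at this

/-- The index of zero is at most `k` exactly when `S ^ k` kills the nilpotent part of `S`. -/
theorem IsDrazin.zeroIndex_le_iff {S J X : Matrix ι ι F} {ν : ℕ} (h : IsDrazin S J X ν) (k : ℕ) :
    zeroIndex S ≤ k ↔ S ^ k * (1 - J) = 0 := by
  obtain ⟨-, -, hSX, -, -, -, hν⟩ := h
  have key : ∀ j, S ^ j * (1 - J) = 0 → (S ^ (j + 1)).rank = (S ^ j).rank := by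
    intro j hj
    apply le_antisymm
    · rw [pow_succ]; exact rank_mul_le_left _ _
    · have : S ^ j = S ^ (j + 1) * X := by
        rw [pow_succ, mul_assoc, hSX]
        rwa [mul_sub, mul_one, sub_eq_zero] at hj
      conv_lhs => rw [this]
      exact rank_mul_le_left _ _
  constructor
  · intro h
    have hmem : zeroIndex S ∈ {k : ℕ | (S ^ (k + 1)).rank = (S ^ k).rank} :=
      Nat.sInf_mem ⟨ν, key ν hν⟩
    set j := zeroIndex S
    have hj : S ^ j * (1 - J) = 0 := by
      refine pow_mul_eq_zero_of_pow_add_mul_eq_zero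
        (fun M hM => pow_mul_eq_zero_of_pow_succ_mul_eq_zero hmem hM) ν ?_
      rw [pow_add, mul_assoc, hν, mul_zero]
    obtain ⟨r, rfl⟩ := Nat.exists_eq_add_of_le h
    rw [add_comm, pow_add, mul_assoc, hj, mul_zero]
  · intro h
    exact Nat.sInf_le (key k h)

/-- The decomposition of the resolvent-like matrix `(1 - s S)⁻¹` into its polynomial part, which
lives on the nilpotent part of `S`, and a strictly proper part. The matrix `T = X - (1 - J)` agrees
with `X` on the range of `J` and is `-1` on the complement. -/
theorem IsDrazin.mul_one_sub_smul {S J X : Matrix ι ι F} {ν : ℕ} (h : IsDrazin S J X ν) (s : F)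
    (hT : (X - (1 - J) - s • (1 : Matrix ι ι F)).det ≠ 0) :
    ((1 - J) * ∑ i ∈ Finset.range ν, (s • S) ^ i +
      (X - (1 - J) - s • (1 : Matrix ι ι F))⁻¹ * X) * (1 - s • S) = 1 := by
  obtain ⟨hc, hJJ, -, hXS, -, hXJ, hν⟩ := h
  set T := X - (1 - J) - s • (1 : Matrix ι ι F) with hTdef
  have h1 : (1 - J) * S ^ ν = 0 := by
    have : Commute (1 - J) S := (Commute.one_left S).sub_left (show Commute J S from hc.symm)
    rw [(this.pow_right ν).eq, hν]
  have h2 : X * (1 - s • S) = T * J := by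
    rw [hTdef, mul_sub, mul_one, mul_smul_comm, hXS, sub_mul, sub_mul, hXJ, sub_mul, one_mul, hJJ,
      sub_self, sub_zero, smul_mul_assoc, one_mul]
  rw [add_mul, mul_assoc, geom_sum_mul_neg, mul_assoc, h2, ← mul_assoc,
    nonsing_inv_mul _ (isUnit_iff_ne_zero.2 hT), one_mul, mul_sub, mul_one, smul_pow,
    mul_smul_comm, h1, smul_zero, sub_zero, sub_add_cancel]

/-- Apart from `-1`, the eigenvalues of `T = X - (1 - J)` are the reciprocals of the non-zero
eigenvalues of `S`. -/
theorem IsDrazin.det_one_sub_smul_eq_zero {S J X : Matrix ι ι F} {ν : ℕ} (h : IsDrazin S J X ν)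
    {s : F}
    (hT : (X - (1 - J) - s • (1 : Matrix ι ι F)).det = 0) (hs : s ≠ -1) :
    (1 - s • S).det = 0 := by
  obtain ⟨-, hJJ, hSX, -, hJX, -, -⟩ := h
  obtain ⟨v, hv, hTv⟩ := exists_mulVec_eq_zero_iff.2 hT
  have hXv : X *ᵥ v = s • (J *ᵥ v) := by
    have h : J * (X - (1 - J) - s • (1 : Matrix ι ι F)) = X - s • J := by
      rw [mul_sub, mul_sub, hJX, mul_sub, mul_one, hJJ, sub_self, sub_zero, mul_smul_comm, mul_one]
    have h' := congrArg (J *ᵥ ·) hTv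
    simp only [mulVec_mulVec, mulVec_zero] at h'
    rw [h, sub_mulVec, smul_mulVec, sub_eq_zero] at h'
    exact h'
  refine exists_mulVec_eq_zero_iff.1 ⟨J *ᵥ v, ?_, ?_⟩
  · intro h0
    rw [h0, smul_zero] at hXv
    rw [sub_mulVec, sub_mulVec, sub_mulVec, hXv, h0, smul_mulVec, one_mulVec, zero_sub, sub_zero,
      ← neg_add', neg_eq_zero] at hTv
    have : (1 + s) • v = 0 := by rw [add_smul, one_smul]; exact hTv
    rcases smul_eq_zero.1 this with h | h
    · exact hs (by linear_combination h)
    · exact hv h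
  · have h := congrArg (S *ᵥ ·) hXv
    simp only [mulVec_mulVec, mulVec_smul, hSX] at h
    rw [sub_mulVec, one_mulVec, smul_mulVec, mulVec_mulVec, ← h, sub_self]

end Drazin

/-! ### Rank conditions and normal form -/

section Rank

variable {F ι κ : Type*} [Field F] [Fintype ι] [Fintype κ]

theorem eq_zero_of_mul_eq_zero_of_hasMaxRank {E : Matrix ι ι F} {C : Matrix κ ι F}
    (h : HasMaxRank (fromRows E C)) {κ' : Type*} {M : Matrix ι κ' F}
    (hE : E * M = 0) (hC : C * M = 0) : M = 0 := by
  have hr : (fromRows E C).rank = Fintype.card ι := by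
    rw [h]; simp
  have h1 := (fromRows E C).mulVecLin.finrank_range_add_finrank_ker
  have hk : LinearMap.ker (fromRows E C).mulVecLin = ⊥ := by
    rw [← Submodule.finrank_eq_zero (R := F)]
    unfold Matrix.rank at hr
    rw [Module.finrank_fintype_fun_eq_card] at h1
    omega
  ext i j
  have hj : (fun i => M i j) ∈ LinearMap.ker (fromRows E C).mulVecLin := by
    rw [LinearMap.mem_ker, mulVecLin_apply, fromRows_mulVec]
    have e1 : E *ᵥ (fun i => M i j) = 0 := by
      ext i; exact congrFun (congrFun hE i) j
    have e2 : C *ᵥ (fun i => M i j) = 0 := by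
      ext i; exact congrFun (congrFun hC i) j
    rw [e1, e2]
    ext i; cases i <;> rfl
  rw [hk, Submodule.mem_bot] at hj
  exact congrFun hj i

theorem eq_zero_of_mul_eq_zero_of_hasMaxRank' {E : Matrix ι ι F} {B : Matrix ι κ F}
    (h : HasMaxRank (fromCols E B)) {κ' : Type*} {M : Matrix κ' ι F}
    (hE : M * E = 0) (hB : M * B = 0) : M = 0 := by
  have h' : HasMaxRank (fromRows Eᵀ Bᵀ) := by
    unfold HasMaxRank at h ⊢
    rw [← transpose_fromCols, rank_transpose, h, min_comm]
  rw [← transpose_eq_zero]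
  refine eq_zero_of_mul_eq_zero_of_hasMaxRank h' ?_ ?_
  · rw [← transpose_mul, hE, transpose_zero]
  · rw [← transpose_mul, hB, transpose_zero]

/-- Descent step for the index. With `S = 𝒜⁻¹ ℰ`, the matrix `Φ = S ^ i (1 - J) 𝒜⁻¹`, here with
`i = j + 1`, is the coefficient of `s ^ i` in the expansion of `(𝒜 - s ℰ)⁻¹` at infinity. When
`S ^ (i + 1) (1 - J) = 0` it is annihilated by `ℰ` from both sides, while `𝒜 Φ` and `Φ 𝒜` vanish in
the second block row and column; so if also its lower right block vanishes, the rank conditions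
force `Φ = 0`. -/
theorem pow_mul_eq_zero_descent [DecidableEq ι] [DecidableEq κ] {E A : Matrix ι ι F}
    {B : Matrix ι κ F} {C : Matrix κ ι F} {D : Matrix κ κ F} (hEB : HasMaxRank (fromCols E B))
    (hEC : HasMaxRank (fromRows E C)) (hA : (bigA A B C D).det ≠ 0) {J : Matrix (ι ⊕ κ) (ι ⊕ κ) F}
    (hc : ((bigA A B C D)⁻¹ * bigE κ E) * J = J * ((bigA A B C D)⁻¹ * bigE κ E)) {j : ℕ}
    (hj : ((bigA A B C D)⁻¹ * bigE κ E) ^ (j + 2) * (1 - J) = 0)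
    (h22 : (((bigA A B C D)⁻¹ * bigE κ E) ^ (j + 1) * (1 - J) * (bigA A B C D)⁻¹).toBlocks₂₂ = 0) :
    ((bigA A B C D)⁻¹ * bigE κ E) ^ (j + 1) * (1 - J) = 0 := by
  have hu := isUnit_iff_ne_zero.2 hA
  set 𝒜 := bigA A B C D with h𝒜
  set ℰ := bigE κ E with hℰ
  set S := 𝒜⁻¹ * ℰ with hS
  have cS : Commute S (1 - J) := (Commute.one_right S).sub_right hc
  have hAS : 𝒜 * S = ℰ := by rw [hS, ← mul_assoc, mul_nonsing_inv _ hu, one_mul]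
  set Φ := S ^ (j + 1) * (1 - J) * 𝒜⁻¹ with hΦ
  have e1 : ℰ * Φ = 0 := by
    rw [← hAS, hΦ, mul_assoc, ← mul_assoc S, ← mul_assoc S, ← pow_succ', hj, zero_mul, mul_zero]
  have e2 : Φ * ℰ = 0 := by
    rw [hΦ, mul_assoc, ← hS, mul_assoc, ← cS.eq, ← mul_assoc, ← pow_succ, hj]
  have e3 : 𝒜 * Φ = ℰ * (S ^ j * (1 - J) * 𝒜⁻¹) := by
    rw [hΦ, ← hAS, pow_succ']; simp only [mul_assoc]
  have e4 : Φ * 𝒜 = (S ^ j * (1 - J) * 𝒜⁻¹) * ℰ := by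
    rw [hΦ, mul_assoc, nonsing_inv_mul _ hu, mul_one, mul_assoc _ 𝒜⁻¹, ← hS, mul_assoc, ← cS.eq,
      ← mul_assoc, ← pow_succ]
  suffices hz : Φ = 0 by
    have := congrArg (· * 𝒜) hz
    simpa [hΦ, mul_assoc, nonsing_inv_mul _ hu] using this
  obtain ⟨a, b, c, d, hblk⟩ : ∃ a b c d, Φ = fromBlocks a b c d :=
    ⟨_, _, _, _, (fromBlocks_toBlocks Φ).symm⟩
  obtain ⟨a', b', c', d', hblk'⟩ : ∃ a b c d, S ^ j * (1 - J) * 𝒜⁻¹ = fromBlocks a b c d :=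
    ⟨_, _, _, _, (fromBlocks_toBlocks (S ^ j * (1 - J) * 𝒜⁻¹)).symm⟩
  rw [hblk'] at e3 e4
  rw [hblk] at e1 e2 e3 e4 h22
  rw [toBlocks_fromBlocks₂₂] at h22
  subst h22
  rw [h𝒜, hℰ, bigA, bigE, fromBlocks_multiply, fromBlocks_multiply, fromBlocks_inj] at e3 e4
  rw [hℰ, bigE, fromBlocks_multiply, ← fromBlocks_zero, fromBlocks_inj] at e1 e2
  simp only [Matrix.zero_mul, Matrix.mul_zero, add_zero] at e1 e2 e3 e4
  have hb : b = 0 := eq_zero_of_mul_eq_zero_of_hasMaxRank hEC e1.2.1 e3.2.2.2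
  have hc0 : c = 0 := eq_zero_of_mul_eq_zero_of_hasMaxRank' hEB e2.2.2.1 e4.2.2.2
  subst hc0
  have ha : a = 0 := eq_zero_of_mul_eq_zero_of_hasMaxRank hEC e1.1 (by simpa using e3.2.2.1)
  rw [hblk, ha, hb, fromBlocks_zero]

/-- Every square matrix `P` over `ℝ` or `ℂ` has a nonsingular `Z` such that `P Z` is a Gram matrix,
and hence positive semidefinite. If `P = U diag(d) V` with nonsingular `U` and `V`, then
`V⁻¹ diag(d') Uᴴ` works, where `d'` is the conjugate of `d` with its zeros replaced by ones. -/
theorem exists_mul_eq_self_mul_conjTranspose {𝕜 : Type*} [RCLike 𝕜] [DecidableEq κ]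
    (P : Matrix κ κ 𝕜) :
    ∃ Z Y : Matrix κ κ 𝕜, Z.det ≠ 0 ∧ P * Z = Y * Yᴴ := by
  obtain ⟨l, l', d, hP⟩ := Pivot.exists_list_transvec_mul_diagonal_mul_list_transvec P
  set U := (l.map TransvectionStruct.toMatrix).prod
  set V := (l'.map TransvectionStruct.toMatrix).prod
  have hU : U.det = 1 := TransvectionStruct.det_toMatrix_prod l
  have hV : V.det = 1 := TransvectionStruct.det_toMatrix_prod l'
  refine ⟨V⁻¹ * diagonal (fun i => if d i = 0 then 1 else star (d i)) * Uᴴ, U * diagonal d, ?_, ?_⟩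
  · rw [det_mul, det_mul, det_conjTranspose, hU, det_nonsing_inv, hV, det_diagonal]
    simp only [Ring.inverse_one, star_one, mul_one, one_mul]
    refine Finset.prod_ne_zero_iff.2 fun i _ => ?_
    split_ifs with h
    · exact one_ne_zero
    · exact (star_ne_zero).2 h
  · rw [hP, conjTranspose_mul, diagonal_conjTranspose]
    have hVu : IsUnit V.det := by rw [hV]; exact isUnit_one
    have hd : diagonal d * diagonal (fun i => if d i = 0 then 1 else star (d i)) =
        diagonal d * diagonal (star d) := by
      rw [diagonal_mul_diagonal, diagonal_mul_diagonal]
      congr 1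
      ext i
      by_cases h : d i = 0 <;> simp [h]
    calc U * diagonal d * V * (V⁻¹ * diagonal (fun i => if d i = 0 then 1 else star (d i)) * Uᴴ)
        = U * (diagonal d * ((V * V⁻¹) * diagonal (fun i => if d i = 0 then 1 else star (d i)))) *
          Uᴴ := by simp only [mul_assoc]
      _ = _ := by rw [mul_nonsing_inv _ hVu, one_mul, hd]; simp only [mul_assoc]

end Rank

/-! ### Base change to complex matrices -/

section BaseChange

variable {𝕜 ι κ l : Type*} [RCLike 𝕜]

/-- The map `x ↦ re x + i im x` from `𝕜 = ℝ` or `𝕜 = ℂ` to `ℂ`, as a ring homomorphism. -/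
noncomputable def complexHom (𝕜 : Type*) [RCLike 𝕜] : 𝕜 →+* ℂ where
  toFun := RCLike.map 𝕜 ℂ
  map_zero' := map_zero _
  map_add' := map_add _
  map_one' := by
    apply Complex.ext <;> simp [RCLike.map]
  map_mul' x y := by
    apply Complex.ext <;> simp [RCLike.map]

theorem toComplex_eq_map (M : Matrix ι κ 𝕜) : toComplex M = M.map (complexHom 𝕜) := rfl

theorem complexHom_star (x : 𝕜) : complexHom 𝕜 (star x) = star (complexHom 𝕜 x) := by
  apply Complex.ext <;> simp [complexHom, RCLike.map]

theorem toComplex_injective : Function.Injective (toComplex : Matrix ι κ 𝕜 → Matrix ι κ ℂ) :=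
  Matrix.map_injective (complexHom 𝕜).injective

@[simp]
theorem toComplex_mul [Fintype κ] (M : Matrix ι κ 𝕜) (N : Matrix κ l 𝕜) :
    toComplex (M * N) = toComplex M * toComplex N :=
  Matrix.map_mul (f := complexHom 𝕜)

@[simp]
theorem toComplex_add (M N : Matrix ι κ 𝕜) : toComplex (M + N) = toComplex M + toComplex N :=
  Matrix.map_add _ (map_add (complexHom 𝕜)) M N

@[simp]
theorem toComplex_sub (M N : Matrix ι κ 𝕜) : toComplex (M - N) = toComplex M - toComplex N :=
  Matrix.map_sub _ (map_sub (complexHom 𝕜)) M N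

@[simp]
theorem toComplex_zero : toComplex (0 : Matrix ι κ 𝕜) = 0 :=
  Matrix.map_zero _ (map_zero (complexHom 𝕜))

@[simp]
theorem toComplex_one [DecidableEq ι] : toComplex (1 : Matrix ι ι 𝕜) = 1 :=
  Matrix.map_one _ (map_zero (complexHom 𝕜)) (map_one (complexHom 𝕜))

theorem toComplex_conjTranspose (M : Matrix ι κ 𝕜) : toComplex Mᴴ = (toComplex M)ᴴ := by
  ext i j
  exact complexHom_star _

theorem toComplex_toBlocks₂₂ (M : Matrix (ι ⊕ κ) (ι ⊕ κ) 𝕜) :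
    toComplex M.toBlocks₂₂ = (toComplex M).toBlocks₂₂ := rfl

theorem toComplex_ofReal_smul (r : ℝ) (M : Matrix ι κ 𝕜) :
    toComplex ((r : 𝕜) • M) = (r : ℂ) • toComplex M := by
  ext i j
  have : complexHom 𝕜 (r : 𝕜) = (r : ℂ) := by
    apply Complex.ext <;> simp [complexHom, RCLike.map]
  change complexHom 𝕜 ((r : 𝕜) * M i j) = (r : ℂ) * complexHom 𝕜 (M i j)
  rw [map_mul, this]

theorem toComplex_bigA (A : Matrix ι ι 𝕜) (B : Matrix ι κ 𝕜)
    (C : Matrix κ ι 𝕜) (D : Matrix κ κ 𝕜) :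
    toComplex (bigA A B C D) = bigA (toComplex A) (toComplex B) (toComplex C) (toComplex D) :=
  fromBlocks_map _ _ _ _ _

theorem toComplex_bigE (E : Matrix ι ι 𝕜) :
    toComplex (bigE κ E) = bigE κ (toComplex E) := by
  simp only [bigE, toComplex_eq_map, fromBlocks_map]
  simp

variable [Fintype ι] [DecidableEq ι]

@[simp]
theorem toComplex_pow (M : Matrix ι ι 𝕜) (k : ℕ) : toComplex (M ^ k) = toComplex M ^ k :=
  map_pow (complexHom 𝕜).mapMatrix M k

theorem det_toComplex (M : Matrix ι ι 𝕜) : (toComplex M).det = complexHom 𝕜 M.det :=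
  ((complexHom 𝕜).map_det M).symm

theorem det_toComplex_ne_zero {M : Matrix ι ι 𝕜} : (toComplex M).det ≠ 0 ↔ M.det ≠ 0 := by
  rw [det_toComplex, ne_eq, map_eq_zero]

@[simp]
theorem toComplex_inv (M : Matrix ι ι 𝕜) : toComplex M⁻¹ = (toComplex M)⁻¹ := by
  by_cases h : M.det = 0
  · rw [nonsing_inv_apply_not_isUnit _ (by simpa using h), nonsing_inv_apply_not_isUnit,
      toComplex_zero]
    simpa [det_toComplex] using h
  · refine (inv_eq_left_inv ?_).symm
    rw [← toComplex_mul, nonsing_inv_mul _ (isUnit_iff_ne_zero.2 h), toComplex_one]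

theorem IsDrazin.toComplex {S J X : Matrix ι ι 𝕜} {ν : ℕ} (h : IsDrazin S J X ν) :
    IsDrazin (toComplex S) (toComplex J) (toComplex X) ν where
  comm := by rw [← toComplex_mul, h.comm, toComplex_mul]
  idem := by rw [← toComplex_mul, h.idem]
  mul_inv := by rw [← toComplex_mul, h.mul_inv]
  inv_mul := by rw [← toComplex_mul, h.inv_mul]
  proj_mul := by rw [← toComplex_mul, h.proj_mul]
  mul_proj := by rw [← toComplex_mul, h.mul_proj]
  nilpotent := by
    rw [← toComplex_one (𝕜 := 𝕜), ← toComplex_sub, ← toComplex_pow, ← toComplex_mul, h.nilpotent,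
      toComplex_zero]

end BaseChange

/-! ### System pencil and closed-loop pencil -/

section Pencil

variable {ι κ : Type*}
variable (E A : Matrix ι ι ℂ) (B : Matrix ι κ ℂ) (C : Matrix κ ι ℂ) (D K L : Matrix κ κ ℂ)

/-- The system pencil `s ℰ - 𝒜`. -/
noncomputable def systemPencil (s : ℂ) : Matrix (ι ⊕ κ) (ι ⊕ κ) ℂ := s • bigE κ E - bigA A B C D

theorem systemPencil_eq (s : ℂ) :
    systemPencil E A B C D s = fromBlocks (s • E - A) (-B) (-C) (-D) := by
  rw [systemPencil, bigE, bigA, fromBlocks_smul, sub_eq_add_neg, fromBlocks_neg, fromBlocks_add]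
  simp [sub_eq_add_neg]

variable [Fintype ι] [DecidableEq ι] [Fintype κ] [DecidableEq κ] (s : ℂ)

/-- The pencil of the closed loop in the unknowns `x` and `v = u + w`, which under `u = K y` satisfy
`(s E - A) x - B v = 0` and `- K C x + (1 - K D) v = w`. -/
noncomputable def closedLoopPencil : Matrix (ι ⊕ κ) (ι ⊕ κ) ℂ :=
  fromBlocks (s • E - A) (-B) (-(K * C)) (1 - K * D)

/-- The closed-loop transfer function from `w` to `z = L y`, computed from the closed-loop pencil.
This formula needs no condition at the eigenvalues of `(E, A)` and the poles of `(1 - G K)⁻¹`. -/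
noncomputable def closedLoopValue : Matrix κ κ ℂ :=
  L * (fromCols C D * (closedLoopPencil E A B C D K s)⁻¹ *
    (fromRows 0 1 : Matrix (ι ⊕ κ) κ ℂ))

/-- The inverse `N(s)` of the transfer function, read off as minus the lower right block of
`(s ℰ - 𝒜)⁻¹`. -/
noncomputable def inverseTransfer : Matrix κ κ ℂ := -((systemPencil E A B C D s)⁻¹).toBlocks₂₂

theorem closedLoopPencil_eq : closedLoopPencil E A B C D K s =
    fromBlocks 1 0 0 K * systemPencil E A B C D s + fromBlocks 0 0 0 1 := by
  rw [systemPencil_eq, closedLoopPencil, fromBlocks_multiply, fromBlocks_add]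
  simp [sub_eq_add_neg, add_comm]

variable {E A B C D K L s}

theorem det_closedLoopPencil (h : (1 - K * D).det ≠ 0) : (closedLoopPencil E A B C D K s).det =
    (1 - K * D).det * (s • E - (A + B * (1 - K * D)⁻¹ * K * C)).det := by
  have : Invertible (1 - K * D) := invertibleOfIsUnitDet _ (isUnit_iff_ne_zero.2 h)
  rw [closedLoopPencil, det_fromBlocks₂₂, invOf_eq_nonsing_inv]
  congr 2
  simp only [Matrix.neg_mul, Matrix.mul_neg, neg_neg, Matrix.mul_assoc]
  abel

theorem isStablePair_iff {A : Matrix ι ι ℂ} :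
    IsStablePair E A ↔ ∀ s : ℂ, 0 ≤ s.re → (s • E - A).det ≠ 0 := by
  constructor
  · intro h s hs h0
    obtain ⟨v, hv⟩ := exists_mulVec_eq_zero_iff.2 h0
    exact absurd (h s ⟨v, hv⟩) (not_lt.2 hs)
  · rintro h s ⟨v, hv⟩
    by_contra hs
    exact h s (not_lt.1 hs) (exists_mulVec_eq_zero_iff.1 ⟨v, hv⟩)

theorem det_closedLoopPencil_eq_mul (hR : (systemPencil E A B C D s).det ≠ 0) :
    (closedLoopPencil E A B C D K s).det =
      (K - inverseTransfer E A B C D s).det * (systemPencil E A B C D s).det := by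
  have hu := isUnit_iff_ne_zero.2 hR
  set R := systemPencil E A B C D s with hRdef
  have h1 : closedLoopPencil E A B C D K s =
      (fromBlocks 1 0 0 K + fromBlocks 0 0 0 1 * R⁻¹) * R := by
    rw [add_mul, mul_assoc, nonsing_inv_mul _ hu, mul_one, closedLoopPencil_eq]
  have h2 : (fromBlocks 1 0 0 K + fromBlocks 0 0 0 1 * R⁻¹ : Matrix (ι ⊕ κ) (ι ⊕ κ) ℂ) =
      fromBlocks 1 0 (R⁻¹).toBlocks₂₁ (K - inverseTransfer E A B C D s) := by
    conv_lhs => rw [← fromBlocks_toBlocks R⁻¹, fromBlocks_multiply, fromBlocks_add]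
    simp [inverseTransfer, ← hRdef]
  rw [h1, det_mul, h2, det_fromBlocks_zero₁₂, det_one, one_mul]

/-- The closed-loop transfer function `M` and the inverse transfer function `N` satisfy
`M (N - K) = L`. -/
theorem closedLoopValue_mul (hR : (systemPencil E A B C D s).det ≠ 0)
    (hΨ : (closedLoopPencil E A B C D K s).det ≠ 0) :
    closedLoopValue E A B C D K L s * (inverseTransfer E A B C D s - K) = L := by
  have hu := isUnit_iff_ne_zero.2 hR
  have hu' := isUnit_iff_ne_zero.2 hΨ
  set R := systemPencil E A B C D s with hRdef
  set Ψ := closedLoopPencil E A B C D K s with hΨdef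
  set N := inverseTransfer E A B C D s with hN
  have h1 : Ψ * (R⁻¹ * (fromRows 0 (-1) : Matrix (ι ⊕ κ) κ ℂ)) =
      (fromRows 0 1 : Matrix (ι ⊕ κ) κ ℂ) * (N - K) := by
    have e : R⁻¹ * (fromRows 0 (-1) : Matrix (ι ⊕ κ) κ ℂ) =
        (fromRows (-(R⁻¹).toBlocks₁₂) N : Matrix (ι ⊕ κ) κ ℂ) := by
      conv_lhs => rw [← fromBlocks_toBlocks R⁻¹, fromBlocks_mul_fromRows]
      simp [hN, inverseTransfer, ← hRdef]
    rw [hΨdef, closedLoopPencil_eq, ← hRdef, Matrix.add_mul, Matrix.mul_assoc, ← Matrix.mul_assoc R,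
      mul_nonsing_inv _ hu, Matrix.one_mul, e, fromBlocks_mul_fromRows, fromBlocks_mul_fromRows,
      fromRows_mul]
    ext (i | i) j <;> simp [sub_eq_add_neg, add_comm]
  have h2 : Ψ⁻¹ * ((fromRows 0 1 : Matrix (ι ⊕ κ) κ ℂ) * (N - K)) =
      R⁻¹ * (fromRows 0 (-1) : Matrix (ι ⊕ κ) κ ℂ) := by
    rw [← h1, ← Matrix.mul_assoc, nonsing_inv_mul _ hu', Matrix.one_mul]
  have h3 : fromCols C D = -((fromCols 0 1 : Matrix κ (ι ⊕ κ) ℂ) * R) := by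
    rw [hRdef, systemPencil_eq, fromCols_mul_fromBlocks]
    ext i (j | j) <;> simp
  rw [closedLoopValue, ← hΨdef, Matrix.mul_assoc, Matrix.mul_assoc, Matrix.mul_assoc, h2, h3,
    Matrix.neg_mul, Matrix.mul_assoc, ← Matrix.mul_assoc R, mul_nonsing_inv _ hu, Matrix.one_mul,
    fromCols_mul_fromRows]
  simp

theorem det_systemPencil_ne_zero (hΨ : (closedLoopPencil E A B C D K s).det ≠ 0)
    (hM : (closedLoopValue E A B C D K L s).det ≠ 0) : (systemPencil E A B C D s).det ≠ 0 := by
  intro h0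
  have hu' := isUnit_iff_ne_zero.2 hΨ
  obtain ⟨z, hz, hRz⟩ := exists_mulVec_eq_zero_iff.2 h0
  set Ψ := closedLoopPencil E A B C D K s with hΨdef
  have hΨz : Ψ *ᵥ z = (fromRows 0 1 : Matrix (ι ⊕ κ) κ ℂ) *ᵥ (z ∘ Sum.inr) := by
    rw [hΨdef, closedLoopPencil_eq, add_mulVec, ← mulVec_mulVec, hRz, mulVec_zero, zero_add,
      fromBlocks_mulVec, fromRows_mulVec]
    ext (i | i) <;> simp
  have hz' : z = Ψ⁻¹ *ᵥ ((fromRows 0 1 : Matrix (ι ⊕ κ) κ ℂ) *ᵥ (z ∘ Sum.inr)) := by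
    rw [← hΨz, mulVec_mulVec, nonsing_inv_mul _ hu', one_mulVec]
  have hy : fromCols C D *ᵥ z = 0 := by
    have h3 : fromCols C D = -((fromCols 0 1 : Matrix κ (ι ⊕ κ) ℂ) * systemPencil E A B C D s) := by
      rw [systemPencil_eq, fromCols_mul_fromBlocks]
      ext i (j | j) <;> simp
    rw [h3, neg_mulVec, ← mulVec_mulVec, hRz, mulVec_zero, neg_zero]
  have hv : z ∘ Sum.inr = 0 := by
    by_contra hv
    refine hM (exists_mulVec_eq_zero_iff.1 ⟨_, hv, ?_⟩)
    rw [closedLoopValue, ← mulVec_mulVec, ← mulVec_mulVec, ← mulVec_mulVec, ← hΨdef, ← hz', hy,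
      mulVec_zero]
  apply hz
  rw [hz', hv, mulVec_zero, mulVec_zero]

theorem det_closedLoopPencil_eq (hE : (s • E - A).det ≠ 0) :
    (closedLoopPencil E A B C D K s).det =
      (s • E - A).det * (1 - K * transferFunction E A B C D s).det := by
  have : Invertible (s • E - A) := invertibleOfIsUnitDet _ (isUnit_iff_ne_zero.2 hE)
  rw [closedLoopPencil, det_fromBlocks₁₁, invOf_eq_nonsing_inv, transferFunction]
  congr 2
  simp only [Matrix.neg_mul, Matrix.mul_neg, neg_neg, Matrix.mul_assoc, Matrix.mul_add]
  abel

theorem closedLoopTransfer_eq (hE : (s • E - A).det ≠ 0)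
    (hΨ : (closedLoopPencil E A B C D K s).det ≠ 0) :
    closedLoopTransfer (transferFunction E A B C D) K L s = closedLoopValue E A B C D K L s := by
  have hu := isUnit_iff_ne_zero.2 hE
  have hu' := isUnit_iff_ne_zero.2 hΨ
  have hKG : (1 - K * transferFunction E A B C D s).det ≠ 0 := by
    rw [det_closedLoopPencil_eq hE] at hΨ
    exact right_ne_zero_of_mul hΨ
  have hGK : (1 - transferFunction E A B C D s * K).det ≠ 0 := by
    rwa [det_one_sub_mul_comm]
  have huK := isUnit_iff_ne_zero.2 hKG
  have huG := isUnit_iff_ne_zero.2 hGK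
  set Ψ := closedLoopPencil E A B C D K s with hΨdef
  set G := transferFunction E A B C D s with hG
  set F := s • E - A with hF
  have h1 : Ψ * (fromRows (F⁻¹ * B) 1 : Matrix (ι ⊕ κ) κ ℂ) =
      (fromRows 0 1 : Matrix (ι ⊕ κ) κ ℂ) * (1 - K * G) := by
    rw [hΨdef, closedLoopPencil, fromBlocks_mul_fromRows, fromRows_mul, ← hF, ← Matrix.mul_assoc,
      mul_nonsing_inv _ hu, hG, transferFunction, ← hF]
    ext (i | i) j
    · simp
    · simp only [fromRows_apply_inr, Matrix.one_mul, Matrix.mul_one, Matrix.neg_mul,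
        Matrix.mul_assoc, Matrix.mul_add]
      simp only [Matrix.add_apply, Matrix.sub_apply, Matrix.neg_apply]
      ring
  have h2 : Ψ⁻¹ * ((fromRows 0 1 : Matrix (ι ⊕ κ) κ ℂ) * (1 - K * G)) = fromRows (F⁻¹ * B) 1 := by
    rw [← h1, ← Matrix.mul_assoc, nonsing_inv_mul _ hu', Matrix.one_mul]
  have h3 : fromCols C D * Ψ⁻¹ * (fromRows 0 1 : Matrix (ι ⊕ κ) κ ℂ) * (1 - K * G) = G := by
    rw [Matrix.mul_assoc, Matrix.mul_assoc, h2, fromCols_mul_fromRows, hG, transferFunction,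
      Matrix.mul_one, Matrix.mul_assoc]
  have h4 : (1 - G * K)⁻¹ * G * (1 - K * G) = G := by
    have : G * (1 - K * G) = (1 - G * K) * G := by noncomm_ring
    rw [mul_assoc, this, ← mul_assoc, nonsing_inv_mul _ huG, one_mul]
  rw [closedLoopTransfer, closedLoopValue, ← hG, ← hΨdef, mul_assoc]
  congr 1
  calc (1 - G * K)⁻¹ * G = (1 - G * K)⁻¹ * G * (1 - K * G) * (1 - K * G)⁻¹ := by
        rw [mul_assoc _ _ (1 - K * G)⁻¹, mul_nonsing_inv _ huK, mul_one]
    _ = fromCols C D * Ψ⁻¹ * (fromRows 0 1 : Matrix (ι ⊕ κ) κ ℂ) * (1 - K * G) * (1 - K * G)⁻¹ := by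
        rw [h4, h3]
    _ = _ := by rw [mul_assoc _ _ (1 - K * G)⁻¹, mul_nonsing_inv _ huK, mul_one]

theorem systemPencil_eq_mul (hA : (bigA A B C D).det ≠ 0) :
    systemPencil E A B C D s =
      -(bigA A B C D * (1 - s • ((bigA A B C D)⁻¹ * bigE κ E))) := by
  rw [systemPencil, mul_sub, mul_one, mul_smul_comm, ← mul_assoc,
    mul_nonsing_inv _ (isUnit_iff_ne_zero.2 hA), one_mul]
  abel

/-- The expansion of the inverse transfer function into a polynomial and a strictly proper
part. -/
theorem inverseTransfer_eq {J X : Matrix (ι ⊕ κ) (ι ⊕ κ) ℂ} {ν : ℕ}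
    (hA : (bigA A B C D).det ≠ 0)
    (h : IsDrazin ((bigA A B C D)⁻¹ * bigE κ E) J X ν)
    (hT : (X - (1 - J) - s • (1 : Matrix (ι ⊕ κ) (ι ⊕ κ) ℂ)).det ≠ 0) :
    (systemPencil E A B C D s).det ≠ 0 ∧ inverseTransfer E A B C D s =
      ∑ i ∈ Finset.range ν,
        s ^ i • (((bigA A B C D)⁻¹ * bigE κ E) ^ i * (1 - J) * (bigA A B C D)⁻¹).toBlocks₂₂ +
      ((X - (1 - J) - s • (1 : Matrix (ι ⊕ κ) (ι ⊕ κ) ℂ))⁻¹ * X * (bigA A B C D)⁻¹).toBlocks₂₂ := by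
  have hinv := h.mul_one_sub_smul s hT
  have hR := systemPencil_eq_mul (E := E) (s := s) hA
  have hu := isUnit_iff_ne_zero.2 hA
  rw [inverseTransfer]
  set 𝒜 := bigA A B C D
  set S := 𝒜⁻¹ * bigE κ E with hS
  set F := (1 - J) * ∑ i ∈ Finset.range ν, (s • S) ^ i +
      (X - (1 - J) - s • (1 : Matrix (ι ⊕ κ) (ι ⊕ κ) ℂ))⁻¹ * X with hF
  have hinv' : -(F * 𝒜⁻¹) * systemPencil E A B C D s = 1 := by
    rw [hR, neg_mul_neg, mul_assoc, ← mul_assoc 𝒜⁻¹, nonsing_inv_mul _ hu, one_mul, hinv]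
  refine ⟨det_ne_zero_of_left_inverse hinv', ?_⟩
  have cS : Commute S (1 - J) := (Commute.one_right S).sub_right h.comm
  have hexp : F * 𝒜⁻¹ = ∑ i ∈ Finset.range ν, s ^ i • (S ^ i * (1 - J) * 𝒜⁻¹) +
      (X - (1 - J) - s • (1 : Matrix (ι ⊕ κ) (ι ⊕ κ) ℂ))⁻¹ * X * 𝒜⁻¹ := by
    rw [hF, add_mul, Finset.mul_sum, Finset.sum_mul]
    congr 1
    refine Finset.sum_congr rfl fun i _ => ?_
    rw [smul_pow, mul_smul_comm, smul_mul_assoc, (cS.pow_left i).eq]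
  rw [inv_eq_left_inv hinv', hexp]
  ext i j
  simp only [toBlocks₂₂, Matrix.add_apply, Matrix.neg_apply, Matrix.sum_apply, Matrix.smul_apply,
    of_apply, neg_neg]

end Pencil

/-! ### Quadratic forms -/

section Quadratic

variable {κ : Type*} [Fintype κ]

theorem re_star_dotProduct_conjTranspose_mulVec (M : Matrix κ κ ℂ) (v : κ → ℂ) :
    (star v ⬝ᵥ Mᴴ *ᵥ v).re = (star v ⬝ᵥ M *ᵥ v).re := by
  have h : star v ⬝ᵥ Mᴴ *ᵥ v = star (star v ⬝ᵥ M *ᵥ v) := by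
    rw [← star_dotProduct_star, star_star, star_mulVec, dotProduct_mulVec, dotProduct_comm]
  rw [h, Complex.star_def, Complex.conj_re]

theorem posDef_add_conjTranspose_iff {M : Matrix κ κ ℂ} :
    (M + Mᴴ).PosDef ↔ ∀ v : κ → ℂ, v ≠ 0 → 0 < (star v ⬝ᵥ M *ᵥ v).re := by
  have hH : (M + Mᴴ).IsHermitian := isHermitian_add_transpose_self M
  have hre : ∀ v : κ → ℂ, (star v ⬝ᵥ (M + Mᴴ) *ᵥ v).re = 2 * (star v ⬝ᵥ M *ᵥ v).re := by
    intro v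
    rw [add_mulVec, dotProduct_add, Complex.add_re, re_star_dotProduct_conjTranspose_mulVec]
    ring
  constructor
  · intro h v hv
    have := (Complex.pos_iff.1 (h.dotProduct_mulVec_pos hv)).1
    rw [hre] at this
    linarith
  · intro h
    refine PosDef.of_dotProduct_mulVec_pos hH fun v hv => Complex.pos_iff.2 ⟨?_, ?_⟩
    · rw [hre]
      have := h v hv
      linarith
    · exact (hH.im_star_dotProduct_mulVec_self v).symm

theorem det_ne_zero_of_re_pos [DecidableEq κ] {M : Matrix κ κ ℂ}
    (h : ∀ v : κ → ℂ, v ≠ 0 → 0 < (star v ⬝ᵥ M *ᵥ v).re) : M.det ≠ 0 := by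
  intro h0
  obtain ⟨v, hv, hMv⟩ := exists_mulVec_eq_zero_iff.2 h0
  have := h v hv
  rw [hMv, dotProduct_zero, Complex.zero_re] at this
  exact lt_irrefl _ this

theorem star_dotProduct_self_eq (v : κ → ℂ) :
    (star v ⬝ᵥ v).re = ∑ i, ‖v i‖ ^ 2 := by
  simp only [dotProduct, Pi.star_apply, Complex.re_sum, Complex.star_def,
    ← Complex.normSq_eq_norm_sq,
    Complex.normSq_apply, Complex.mul_re, Complex.conj_re, Complex.conj_im]
  exact Finset.sum_congr rfl fun i _ => by ring

theorem norm_star_dotProduct_mulVec_le {M : Matrix κ κ ℂ} {c : ℝ} (hc : ∀ i j, ‖M i j‖ ≤ c)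
    (hc0 : 0 ≤ c) (v : κ → ℂ) :
    ‖star v ⬝ᵥ M *ᵥ v‖ ≤ c * Fintype.card κ * ∑ i, ‖v i‖ ^ 2 := by
  have h1 : ‖star v ⬝ᵥ M *ᵥ v‖ ≤ ∑ i, ∑ j, c * ((‖v i‖ ^ 2 + ‖v j‖ ^ 2) / 2) := by
    simp only [dotProduct, mulVec, Finset.mul_sum]
    refine (norm_sum_le _ _).trans (Finset.sum_le_sum fun i _ => (norm_sum_le _ _).trans
      (Finset.sum_le_sum fun j _ => ?_))
    rw [norm_mul, norm_mul, Pi.star_apply, norm_star]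
    calc ‖v i‖ * (‖M i j‖ * ‖v j‖) = ‖M i j‖ * (‖v i‖ * ‖v j‖) := by ring
      _ ≤ c * ((‖v i‖ ^ 2 + ‖v j‖ ^ 2) / 2) := by
        gcongr
        · exact hc i j
        · nlinarith [sq_nonneg (‖v i‖ - ‖v j‖)]
  refine h1.trans (le_of_eq ?_)
  simp only [← Finset.mul_sum, ← Finset.sum_div, Finset.sum_add_distrib, Finset.sum_const,
    Finset.card_univ, nsmul_eq_mul]
  ring

theorem eq_zero_of_forall_star_dotProduct_mulVec [DecidableEq κ] {M : Matrix κ κ ℂ}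
    (h : ∀ v : κ → ℂ, star v ⬝ᵥ M *ᵥ v = 0) : M = 0 := by
  have h1 : Matrix.toEuclideanLin M = 0 := by
    rw [← inner_map_self_eq_zero]
    intro x
    have h2 : inner ℂ x (Matrix.toEuclideanLin M x) = star x.ofLp ⬝ᵥ M *ᵥ x.ofLp := by
      rw [EuclideanSpace.inner_eq_star_dotProduct, dotProduct_comm]
      rfl
    rw [← inner_conj_symm, h2, h, map_zero]
  simpa using h1

end Quadratic

/-! ### Limits and growth -/

section Limits

variable {ι κ : Type*} [Fintype ι] [DecidableEq ι] [Fintype κ]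

theorem tendsto_matrix_inv {α : Type*} {l : Filter α} {f : α → Matrix ι ι ℂ} {M : Matrix ι ι ℂ}
    (hf : Tendsto f l (𝓝 M)) (hM : M.det ≠ 0) : Tendsto (fun a => (f a)⁻¹) l (𝓝 M⁻¹) := by
  have hdet : Tendsto (fun a => (f a).det) l (𝓝 M.det) :=
    ((continuous_id.matrix_det (A := fun M : Matrix ι ι ℂ => M)).tendsto M).comp hf
  have hadj : Tendsto (fun a => (f a).adjugate) l (𝓝 M.adjugate) :=
    ((continuous_id.matrix_adjugate (A := fun M : Matrix ι ι ℂ => M)).tendsto M).comp hf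
  simp only [inv_def, Ring.inverse_eq_inv']
  exact (hdet.inv₀ hM).smul hadj

theorem finite_setOf_det_smul_sub_eq_zero {F : Type*} [Field F] {E A : Matrix ι ι F}
    (h : ∃ s : F, (s • E - A).det ≠ 0) : {s : F | (s • E - A).det = 0}.Finite := by
  set p : Polynomial F :=
    ((Polynomial.X : Polynomial F) • E.map Polynomial.C - A.map Polynomial.C).det with hp
  have heval : ∀ s, p.eval s = (s • E - A).det := by
    intro s
    rw [hp, ← Polynomial.coe_evalRingHom, RingHom.map_det]
    congr 1
    ext i j
    simpa using mul_comm _ _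
  have hp0 : p ≠ 0 := by
    obtain ⟨s, hs⟩ := h
    intro h0
    rw [← heval, h0, Polynomial.eval_zero] at hs
    exact hs rfl
  refine (Polynomial.finite_setOfPred_isRoot hp0).subset fun s hs => ?_
  change p.eval s = 0
  rw [heval]
  exact hs

/-- At a point where the closed-loop pencil is nonsingular, the closed-loop transfer function has
no pole, even if the formula defining it breaks down there. -/
theorem tendsto_closedLoopTransfer [DecidableEq κ] {E A : Matrix ι ι ℂ}
    {B : Matrix ι κ ℂ} {C : Matrix κ ι ℂ} {D K L : Matrix κ κ ℂ} {s : ℂ} (hreg : IsRegularPair E A)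
    (hΨ : (closedLoopPencil E A B C D K s).det ≠ 0) :
    Tendsto (closedLoopTransfer (transferFunction E A B C D) K L) (𝓝[≠] s)
      (𝓝 (closedLoopValue E A B C D K L s)) := by
  have hcont : Continuous (closedLoopPencil E A B C D K) := by
    unfold closedLoopPencil
    have h1 : Continuous (fun s : ℂ => s • E - A) := by fun_prop
    exact h1.matrix_fromBlocks continuous_const continuous_const continuous_const
  have hinv : Tendsto (fun s' => (closedLoopPencil E A B C D K s')⁻¹) (𝓝[≠] s)
      (𝓝 (closedLoopPencil E A B C D K s)⁻¹) :=
    tendsto_matrix_inv ((hcont.tendsto s).mono_left nhdsWithin_le_nhds) hΨ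
  have hV : Tendsto (closedLoopValue E A B C D K L) (𝓝[≠] s)
      (𝓝 (closedLoopValue E A B C D K L s)) := by
    have hc : Continuous (fun M : Matrix (ι ⊕ κ) (ι ⊕ κ) ℂ =>
        L * (fromCols C D * M * (fromRows 0 1 : Matrix (ι ⊕ κ) κ ℂ))) := by
      refine continuous_const.matrix_mul ?_
      exact (continuous_const.matrix_mul continuous_id).matrix_mul continuous_const
    exact (hc.tendsto _).comp hinv
  refine hV.congr' ?_
  have h1 : ∀ᶠ s' in 𝓝[≠] s, (s' • E - A).det ≠ 0 :=
    nhdsNE_le_cofinite s (finite_setOf_det_smul_sub_eq_zero hreg).eventually_cofinite_notMem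
  have h2 : ∀ᶠ s' in 𝓝[≠] s, (closedLoopPencil E A B C D K s').det ≠ 0 :=
    (hcont.matrix_det.continuousAt.eventually_ne hΨ).filter_mono nhdsWithin_le_nhds
  filter_upwards [h1, h2] with s' h1 h2
  exact (closedLoopTransfer_eq h1 h2).symm

open scoped Matrix.Norms.Operator in
theorem tendsto_inv_sub_smul_one_cobounded (T : Matrix ι ι ℂ) :
    Tendsto (fun s : ℂ => (T - s • (1 : Matrix ι ι ℂ))⁻¹) (Bornology.cobounded ℂ) (𝓝 0) := by
  have h := (spectrum.resolvent_tendsto_cobounded (𝕜 := ℂ) T).neg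
  rw [neg_zero] at h
  refine h.congr fun s => ?_
  rw [resolvent, ← Matrix.nonsing_inv_eq_ringInverse, ← neg_sub, Algebra.algebraMap_eq_smul_one]
  have hn : ∀ M : Matrix ι ι ℂ, (-M)⁻¹ = -M⁻¹ := fun M => by
    by_cases hM : IsUnit M.det
    · refine inv_eq_left_inv ?_
      rw [neg_mul_neg, nonsing_inv_mul _ hM]
    · have hM' : ¬ IsUnit (-M).det := by
        rw [isUnit_iff_ne_zero] at hM ⊢
        simpa [det_neg] using hM
      rw [nonsing_inv_apply_not_isUnit _ hM, nonsing_inv_apply_not_isUnit _ hM', neg_zero]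
  rw [hn, neg_neg]

theorem exists_norm_le_of_tendsto_cobounded {V : Type*} [NormedAddCommGroup V] {f : ℂ → V} {a : V}
    {Y : Set ℂ} (hY : IsClosed Y) (hf : ContinuousOn f Y)
    (ha : Tendsto f (Bornology.cobounded ℂ) (𝓝 a)) : ∃ c, ∀ s ∈ Y, ‖f s‖ ≤ c := by
  have h1 : ∀ᶠ s in cocompact ℂ, ‖f s‖ < ‖a‖ + 1 := by
    rw [← Metric.cobounded_eq_cocompact]
    exact ha.norm.eventually_lt_const (lt_add_one _)
  obtain ⟨t, ht, hts⟩ := mem_cocompact.1 h1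
  obtain ⟨c, hc⟩ := (ht.inter_right hY).exists_bound_of_continuousOn
    (hf.mono Set.inter_subset_right)
  refine ⟨max c (‖a‖ + 1), fun s hs => ?_⟩
  by_cases hst : s ∈ t
  · exact (hc s ⟨hst, hs⟩).trans (le_max_left _ _)
  · exact (le_of_lt (hts hst)).trans (le_max_right _ _)

/-- A Hurwitz matrix `T` has a bounded resolvent on a slightly larger half plane than
`{s | 0 ≤ re s}`, and so every continuous matrix function `g` of the resolvent is bounded there. -/
theorem exists_resolvent_bound {T : Matrix ι ι ℂ}
    (hT : ∀ s : ℂ, (T - s • (1 : Matrix ι ι ℂ)).det = 0 → s.re < 0) :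
    ∃ ε : ℝ, 0 < ε ∧ (∀ s : ℂ, -ε ≤ s.re → (T - s • (1 : Matrix ι ι ℂ)).det ≠ 0) ∧
      ∀ g : Matrix ι ι ℂ → Matrix κ κ ℂ, Continuous g → ∃ c : ℝ, 0 ≤ c ∧
        ∀ s : ℂ, -ε ≤ s.re → ∀ i j, ‖g (T - s • (1 : Matrix ι ι ℂ))⁻¹ i j‖ ≤ c := by
  have hfin : {s : ℂ | (T - s • (1 : Matrix ι ι ℂ)).det = 0}.Finite := by
    have h := finite_setOf_det_smul_sub_eq_zero (E := -1) (A := -T) ⟨0, fun h0 => by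
      have := hT 0 (by simpa using h0)
      simp at this⟩
    simpa [sub_eq_add_neg, add_comm] using h
  obtain ⟨ε, hε, hεT⟩ : ∃ ε : ℝ, 0 < ε ∧
      ∀ s : ℂ, -ε ≤ s.re → (T - s • (1 : Matrix ι ι ℂ)).det ≠ 0 := by
    have h := (Set.Finite.eventually_all hfin (l := 𝓝[>] (0 : ℝ))
      (p := fun s ε => s.re < -ε)).2 fun s hs => by
        have := hT s hs
        filter_upwards [Ioo_mem_nhdsGT (neg_pos.2 this)] with ε hε
        linarith [hε.2]
    obtain ⟨ε, h1, h2⟩ := (h.and self_mem_nhdsWithin).exists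
    exact ⟨ε, h2, fun s hs h0 => absurd (h1 s h0) (not_lt.2 hs)⟩
  refine ⟨ε, hε, hεT, fun g hg => ?_⟩
  let : NormedAddCommGroup (Matrix κ κ ℂ) := Matrix.normedAddCommGroup
  obtain ⟨c, hc⟩ := exists_norm_le_of_tendsto_cobounded (Y := {s : ℂ | -ε ≤ s.re})
    (f := fun s => g (T - s • (1 : Matrix ι ι ℂ))⁻¹) (a := g 0)
    (isClosed_le continuous_const Complex.continuous_re)
    (fun s hs => by
      have h1 : Tendsto (fun s : ℂ => T - s • (1 : Matrix ι ι ℂ)) (𝓝 s)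
          (𝓝 (T - s • (1 : Matrix ι ι ℂ))) := by
        have : Continuous (fun s : ℂ => T - s • (1 : Matrix ι ι ℂ)) := by fun_prop
        exact this.tendsto s
      have h2 := tendsto_matrix_inv h1 (hεT s hs)
      exact ((hg.tendsto _).comp h2).mono_left nhdsWithin_le_nhds)
    ((hg.tendsto 0).comp (tendsto_inv_sub_smul_one_cobounded T))
  refine ⟨max c 0, le_max_right _ _, fun s hs i j => ?_⟩
  exact (Matrix.norm_entry_le_entrywise_sup_norm _).trans ((hc s hs).trans (le_max_left _ _))

/-- For `d ≥ 2` every `w` has a `d`-th root in the closed right half plane. -/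
theorem exists_pow_eq_re_nonneg {d : ℕ} (hd : 2 ≤ d) (w : ℂ) : ∃ z : ℂ, z ^ d = w ∧ 0 ≤ z.re := by
  refine ⟨w ^ ((d : ℂ)⁻¹), Complex.cpow_nat_inv_pow w (by omega), ?_⟩
  rcases eq_or_ne w 0 with rfl | hw
  · rw [Complex.zero_cpow (by simp; omega)]; simp
  · rw [Complex.cpow_def_of_ne_zero hw, Complex.exp_re]
    refine mul_nonneg (Real.exp_pos _).le (Real.cos_nonneg_of_mem_Icc ?_)
    have him : (Complex.log w * (d : ℂ)⁻¹).im = w.arg / d := by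
      have : ((d : ℂ)⁻¹) = (((d : ℝ)⁻¹ : ℝ) : ℂ) := by push_cast; rfl
      rw [this, Complex.im_mul_ofReal, Complex.log_im, div_eq_mul_inv]
    rw [him]
    have h2 : (2 : ℝ) ≤ d := by exact_mod_cast hd
    have hd0 : (0 : ℝ) < d := by linarith
    have hpi := Real.pi_pos
    constructor
    · rw [le_div_iff₀ hd0]
      nlinarith [Complex.neg_pi_lt_arg w]
    · rw [div_le_iff₀ hd0]
      nlinarith [Complex.arg_le_pi w]

/-- A polynomial which, up to a function with a limit at infinity, has nonnegative real part on the
closed right half plane has degree at most one: for `d ≥ 2` the powers `ω ^ d` with `re ω ≥ 0`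
take all arguments, so that a leading term `c s ^ d` would be very negative on some ray. -/
theorem natDegree_le_one_of_re_nonneg {p : Polynomial ℂ} {f : ℂ → ℂ} {a : ℂ}
    (hf : Tendsto f (Bornology.cobounded ℂ) (𝓝 a))
    (h : ∀ s : ℂ, 0 ≤ s.re → 0 ≤ (p.eval s + f s).re) : p.natDegree ≤ 1 := by
  by_contra! hd
  set d := p.natDegree with hdef
  have hc : p.leadingCoeff ≠ 0 := by
    rw [Polynomial.leadingCoeff_ne_zero]
    rintro rfl
    simp [hdef] at hd
  set c := p.leadingCoeff with hcdef
  obtain ⟨ω, hω, hωre⟩ := exists_pow_eq_re_nonneg hd (-(starRingEnd ℂ) c)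
  have hω0 : ω ≠ 0 := by
    rintro rfl
    rw [zero_pow (by omega)] at hω
    exact hc (by simpa using hω.symm)
  have hray : Tendsto (fun r : ℝ => (r : ℂ) * ω) atTop (Bornology.cobounded ℂ) := by
    rw [← tendsto_norm_atTop_iff_cobounded]
    simp only [norm_mul, Complex.norm_real]
    exact tendsto_norm_atTop_atTop.atTop_mul_const (norm_pos_iff.2 hω0)
  have hlim : Tendsto (fun r : ℝ => (p.eval (r * ω) + f (r * ω)) / (r : ℂ) ^ d) atTop
      (𝓝 (c * ω ^ d)) := by
    have hinv : ∀ k : ℕ, k < d → Tendsto (fun r : ℝ => (r : ℂ) ^ k / (r : ℂ) ^ d) atTop (𝓝 0) := by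
      intro k hk
      have := tendsto_pow_div_pow_atTop_zero (𝕜 := ℝ) hk
      have := (Complex.continuous_ofReal.tendsto 0).comp this
      simpa [Function.comp_def] using this
    have h1 : Tendsto (fun r : ℝ => ∑ i ∈ Finset.range d,
        p.coeff i * ω ^ i * ((r : ℂ) ^ i / (r : ℂ) ^ d)) atTop (𝓝 0) := by
      have := tendsto_finsetSum (Finset.range d) fun i hi =>
        (hinv i (Finset.mem_range.1 hi)).const_mul (p.coeff i * ω ^ i)
      simpa using this
    have h2 : Tendsto (fun r : ℝ => f (r * ω) * ((r : ℂ) ^ 0 / (r : ℂ) ^ d)) atTop (𝓝 0) := by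
      have := (hf.comp hray).mul (hinv 0 (by omega))
      simpa [Function.comp_def] using this
    have h3 := (h1.add (tendsto_const_nhds (x := c * ω ^ d))).add h2
    simp only [zero_add, add_zero] at h3
    refine h3.congr' ?_
    filter_upwards [eventually_gt_atTop 0] with r hr
    have hr' : (r : ℂ) ^ d ≠ 0 := pow_ne_zero _ (by exact_mod_cast hr.ne')
    rw [Polynomial.eval_eq_sum_range, ← hdef, Finset.sum_range_succ, add_div, add_div,
      Finset.sum_div]
    congr 1
    · congr 1
      · exact Finset.sum_congr rfl fun i _ => by rw [mul_pow]; ring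
      · rw [mul_pow, hcdef, Polynomial.leadingCoeff, ← hdef]
        field_simp
    · rw [pow_zero]; ring
  have hneg : (c * ω ^ d).re < 0 := by
    rw [hω, mul_neg, Complex.mul_conj, Complex.neg_re, Complex.ofReal_re]
    exact neg_lt_zero.2 (Complex.normSq_pos.2 hc)
  refine absurd (ge_of_tendsto ((Complex.continuous_re.tendsto _).comp hlim) ?_) (not_le.2 hneg)
  filter_upwards [eventually_gt_atTop 0] with r hr
  have hpos := h (r * ω) (by rw [Complex.re_ofReal_mul]; positivity)
  have : (r : ℂ) ^ d = ((r ^ d : ℝ) : ℂ) := by push_cast; rfl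
  simp only [Function.comp_apply]
  rw [this, Complex.div_ofReal_re]
  positivity

end Limits

/-! ### Sufficiency -/

section Main

variable {𝕜 ι κ : Type*} [RCLike 𝕜] [Fintype ι] [DecidableEq ι] [Fintype κ] [DecidableEq κ]
variable {E A : Matrix ι ι 𝕜} {B : Matrix ι κ 𝕜} {C : Matrix κ ι 𝕜} {D : Matrix κ κ 𝕜}

theorem exists_gt_det_one_add_smul_ne_zero (M : Matrix κ κ 𝕜) (b : ℝ) :
    ∃ k : ℝ, b < k ∧ (1 + (k : 𝕜) • M).det ≠ 0 := by
  have hfin := finite_setOf_det_smul_sub_eq_zero (E := M) (A := -1) ⟨0, by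
    rw [zero_smul, zero_sub, neg_neg, det_one]
    exact one_ne_zero⟩
  obtain ⟨k, hk, hk'⟩ := (Set.Ioi_infinite b).exists_notMem_finite
    (hfin.preimage (f := ((↑) : ℝ → 𝕜)) RCLike.ofReal_injective.injOn)
  refine ⟨k, hk, fun h => hk' ?_⟩
  change ((k : 𝕜) • M - -1).det = 0
  rwa [sub_neg_eq_add, add_comm]

/-- Sufficiency. By the index condition the inverse transfer function has the form
`N(s) = s P + W(s)` with `W` bounded on a half plane `-ε ≤ re s`. Choosing `Z` with `P Z` positive
semidefinite, `L = Z⁻¹` and `K = -k Z⁻¹`, one finds `(N - K) Z = s P Z + k + W Z`, whose Hermitian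
part is positive definite there for large `k`, and this matrix function is the inverse of the
closed-loop transfer function. -/
theorem exists_feedback (hreg : IsRegularPair (toComplex E) (toComplex A))
    (hA : (bigA A B C D).det ≠ 0)
    (hev : ∀ μ : ℂ, μ ≠ 0 → Module.End.HasEigenvalue
      (Matrix.toLin' (toComplex ((bigA A B C D)⁻¹ * bigE κ E))) μ → μ.re < 0)
    (hidx : zeroIndex ((bigA A B C D)⁻¹ * bigE κ E) ≤ 2) :
    ∃ K L : Matrix κ κ 𝕜,
      (1 - K * D).det ≠ 0 ∧
      IsStablePair (toComplex E) (toComplex (A + B * (1 - K * D)⁻¹ * K * C)) ∧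
      IsSPR (closedLoopTransfer
        (transferFunction (toComplex E) (toComplex A) (toComplex B) (toComplex C) (toComplex D))
        (toComplex K) (toComplex L)) := by
  set S := (bigA A B C D)⁻¹ * bigE κ E with hS
  obtain ⟨J, X, ν, hd⟩ := exists_isDrazin S
  have hd2 : IsDrazin S J X 2 := { hd with nilpotent := (hd.zeroIndex_le_iff 2).1 hidx }
  obtain ⟨Z, Y, hZ, hPZ⟩ := exists_mul_eq_self_mul_conjTranspose
    (S * (1 - J) * (bigA A B C D)⁻¹).toBlocks₂₂
  set E' := toComplex E with hE'
  set A' := toComplex A with hA'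
  set B' := toComplex B with hB'
  set C' := toComplex C with hC'
  set D' := toComplex D with hD'
  set J' := toComplex J with hJ'
  set X' := toComplex X with hX'
  set Z' := toComplex Z with hZ'
  set Y' := toComplex Y with hY'
  have hAbig : toComplex (bigA A B C D) = bigA A' B' C' D' := toComplex_bigA _ _ _ _
  have hSbig : toComplex S = (bigA A' B' C' D')⁻¹ * bigE κ E' := by
    rw [hS, toComplex_mul, toComplex_inv, toComplex_bigA, toComplex_bigE]
  have hA0 : (bigA A' B' C' D').det ≠ 0 := by
    rw [← hAbig]; exact det_toComplex_ne_zero.2 hA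
  set S' := (bigA A' B' C' D')⁻¹ * bigE κ E' with hS'
  have hd' : IsDrazin S' J' X' 2 := hSbig ▸ hd2.toComplex
  set P' := (S' * (1 - J') * (bigA A' B' C' D')⁻¹).toBlocks₂₂ with hP'
  have hPZ' : P' * Z' = Y' * Y'ᴴ := by
    have := congrArg toComplex hPZ
    rw [toComplex_mul, toComplex_mul, toComplex_conjTranspose, toComplex_toBlocks₂₂, toComplex_mul,
      toComplex_mul, toComplex_sub, toComplex_one, toComplex_inv, hAbig, hSbig] at this
    exact this
  set T := X' - (1 - J') with hT
  have hTs : ∀ s : ℂ, (T - s • (1 : Matrix (ι ⊕ κ) (ι ⊕ κ) ℂ)).det = 0 → s.re < 0 := by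
    intro s hs
    by_cases hs1 : s = -1
    · rw [hs1]; norm_num
    obtain ⟨v, hv, hv0⟩ := exists_mulVec_eq_zero_iff.2
      (hd'.det_one_sub_smul_eq_zero hs hs1)
    rw [sub_mulVec, one_mulVec, smul_mulVec, sub_eq_zero] at hv0
    have hs0 : s ≠ 0 := by
      rintro rfl
      rw [zero_smul] at hv0
      exact hv hv0
    have hre : (s⁻¹).re < 0 := by
      refine hev s⁻¹ (inv_ne_zero hs0) (Module.End.hasEigenvalue_of_hasEigenvector
        (Module.End.hasEigenvector_iff.2 ⟨Module.End.mem_eigenspace_iff.2 ?_, hv⟩))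
      rw [hSbig, toLin'_apply]
      conv_rhs => rw [hv0]
      rw [smul_smul, inv_mul_cancel₀ hs0, one_smul]
    rw [Complex.inv_re] at hre
    by_contra! hcon
    exact absurd hre (not_lt.2 (div_nonneg hcon (Complex.normSq_nonneg _)))
  obtain ⟨ε, hε, hεT, hbound⟩ := exists_resolvent_bound (κ := κ) hTs
  -- `g` applied to the resolvent is the part of `N(s) Z` that stays bounded; the shift by `ε P Z`
  -- makes the remaining part `(s + ε) P Z` positive on the half plane `-ε ≤ re s`.
  set g : Matrix (ι ⊕ κ) (ι ⊕ κ) ℂ → Matrix κ κ ℂ := fun M =>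
    (((1 - J') * (bigA A' B' C' D')⁻¹).toBlocks₂₂ +
      (M * X' * (bigA A' B' C' D')⁻¹).toBlocks₂₂) * Z' - (ε : ℂ) • (P' * Z') with hg
  have hgc : Continuous g := by
    have h1 : Continuous fun M : Matrix (ι ⊕ κ) (ι ⊕ κ) ℂ =>
        (M * X' * (bigA A' B' C' D')⁻¹).toBlocks₂₂ :=
      (((continuous_id.matrix_mul continuous_const).matrix_mul
        continuous_const).matrix_submatrix Sum.inr Sum.inr)
    exact ((continuous_const.add h1).matrix_mul continuous_const).sub continuous_const
  obtain ⟨c, hc0, hgb⟩ := hbound g hgc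
  -- `k` dominates the bounded part and keeps `1 - K D = 1 + k Z⁻¹ D` nonsingular.
  obtain ⟨k, hk, hkD⟩ := exists_gt_det_one_add_smul_ne_zero (Z⁻¹ * D) (c * Fintype.card κ)
  have hZ0 : Z'.det ≠ 0 := det_toComplex_ne_zero.2 hZ
  have hZu := isUnit_iff_ne_zero.2 hZ0
  refine ⟨-((k : 𝕜) • Z⁻¹), Z⁻¹, ?_⟩
  set K : Matrix κ κ 𝕜 := -((k : 𝕜) • Z⁻¹) with hK
  set K' := toComplex K with hK'
  set L' := toComplex Z⁻¹ with hL'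
  have hLZ : L' * Z' = 1 := by
    rw [hL', toComplex_inv, nonsing_inv_mul _ hZu]
  have hK'eq : K' * Z' = -((k : ℂ) • (1 : Matrix κ κ ℂ)) := by
    rw [hK', hK, ← neg_smul, ← RCLike.ofReal_neg, toComplex_ofReal_smul, ← hL', smul_mul_assoc, hLZ]
    simp
  have hKD : (1 - K * D).det ≠ 0 := by
    rwa [hK, neg_mul, sub_neg_eq_add, smul_mul_assoc]
  have hKD' : (1 - K' * D').det ≠ 0 := by
    rw [hK', hD', ← toComplex_mul, ← toComplex_one (𝕜 := 𝕜), ← toComplex_sub]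
    exact det_toComplex_ne_zero.2 hKD
  have hR : ∀ s : ℂ, -ε ≤ s.re → (systemPencil E' A' B' C' D' s).det ≠ 0 ∧
      (inverseTransfer E' A' B' C' D' s - K') * Z' =
        (s + ε) • (P' * Z') + (k : ℂ) • 1 + g (T - s • (1 : Matrix (ι ⊕ κ) (ι ⊕ κ) ℂ))⁻¹ := by
    intro s hs
    obtain ⟨h1, h3⟩ := inverseTransfer_eq (s := s) hA0 hd' (hεT s hs)
    refine ⟨h1, ?_⟩
    rw [h3, Finset.sum_range_succ, Finset.sum_range_one, pow_zero, pow_zero, pow_one, pow_one,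
      one_smul, one_mul, ← hP', sub_mul, hK'eq, add_smul, add_mul, add_mul, smul_mul_assoc]
    simp only [hg, add_mul]
    abel
  have hpos : ∀ s : ℂ, -ε ≤ s.re → ∀ v : κ → ℂ, v ≠ 0 →
      0 < (star v ⬝ᵥ ((inverseTransfer E' A' B' C' D' s - K') * Z') *ᵥ v).re := by
    intro s hs v hv
    rw [(hR s hs).2, add_mulVec, add_mulVec, smul_mulVec, smul_mulVec, one_mulVec, dotProduct_add,
      dotProduct_add, dotProduct_smul, dotProduct_smul, Complex.add_re, Complex.add_re, smul_eq_mul,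
      smul_eq_mul, Complex.re_ofReal_mul, star_dotProduct_self_eq]
    have hps := Complex.nonneg_iff.1
      ((posSemidef_self_mul_conjTranspose Y').dotProduct_mulVec_nonneg v)
    rw [← hPZ'] at hps
    have h1 : 0 ≤ ((s + ε) * (star v ⬝ᵥ (P' * Z') *ᵥ v)).re := by
      rw [Complex.mul_re, ← hps.2, mul_zero, sub_zero, Complex.add_re, Complex.ofReal_re]
      exact mul_nonneg (by linarith) hps.1
    have h3 := norm_star_dotProduct_mulVec_le (hgb s hs) hc0 v
    have h4 := (abs_le.1 (Complex.abs_re_le_norm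
      (star v ⬝ᵥ g (T - s • (1 : Matrix (ι ⊕ κ) (ι ⊕ κ) ℂ))⁻¹ *ᵥ v))).1
    have h5 : 0 < ∑ i, ‖v i‖ ^ 2 := by
      obtain ⟨i, hi⟩ := Function.ne_iff.1 hv
      exact Finset.sum_pos' (fun _ _ => sq_nonneg _)
        ⟨i, Finset.mem_univ i, pow_pos (norm_pos_iff.2 hi) 2⟩
    have h6 := mul_lt_mul_of_pos_right hk h5
    linarith
  have hΨ : ∀ s : ℂ, -ε ≤ s.re → (closedLoopPencil E' A' B' C' D' K' s).det ≠ 0 := by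
    intro s hs
    have h1 := det_ne_zero_of_re_pos (hpos s hs)
    rw [det_mul] at h1
    rw [det_closedLoopPencil_eq_mul (hR s hs).1, ← neg_sub, det_neg]
    exact mul_ne_zero (mul_ne_zero (pow_ne_zero _ (neg_ne_zero.2 one_ne_zero))
      (left_ne_zero_of_mul h1)) (hR s hs).1
  refine ⟨hKD, ?_, ε, hε, ?_⟩
  · rw [isStablePair_iff]
    intro s hs
    have h1 := hΨ s (by linarith)
    rw [det_closedLoopPencil hKD'] at h1
    have h3 : toComplex (A + B * (1 - K * D)⁻¹ * K * C) =
        A' + B' * (1 - K' * D')⁻¹ * K' * C' := by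
      simp [hA', hB', hK', hD', hC']
    rw [h3]
    exact right_ne_zero_of_mul h1
  · intro s M hs hM
    have hMeq : M = closedLoopValue E' A' B' C' D' K' L' s :=
      tendsto_nhds_unique hM (tendsto_closedLoopTransfer hreg (hΨ s hs))
    have h1 := closedLoopValue_mul (L := L') (hR s hs).1 (hΨ s hs)
    rw [← hMeq] at h1
    set H := (inverseTransfer E' A' B' C' D' s - K') * Z' with hH
    have hMH : M * H = 1 := by rw [hH, ← mul_assoc, h1, hLZ]
    have hHM : H * M = 1 := mul_eq_one_comm.1 hMH
    rw [posDef_add_conjTranspose_iff]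
    intro v hv
    have hv' : M *ᵥ v ≠ 0 := by
      intro h0
      apply hv
      rw [← one_mulVec v, ← hHM, ← mulVec_mulVec, h0, mulVec_zero]
    have h3 := hpos s hs (M *ᵥ v) hv'
    rw [← re_star_dotProduct_conjTranspose_mulVec]
    rwa [← hH, mulVec_mulVec, hHM, one_mulVec, star_mulVec, ← dotProduct_mulVec] at h3

/-! ### Necessity -/

/-- Necessity. A vector in the kernel of `s ℰ - 𝒜`, `re s ≥ 0`, would give a vector in the kernel
of the closed-loop transfer function `M(s)`, which has positive definite Hermitian part; this
yields the eigenvalue condition. Since `M (N - K) = L`, also `Lᴴ (N - K)` has nonnegative Hermitian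
part on the right half plane, so `N` grows at most linearly, and the rank conditions transfer this
bound from the block `N` of `(s ℰ - 𝒜)⁻¹` to the index. -/
theorem conditions_of_feedback (hreg : IsRegularPair (toComplex E) (toComplex A))
    (hEB : HasMaxRank (fromCols E B)) (hEC : HasMaxRank (fromRows E C)) {K L : Matrix κ κ 𝕜}
    (hKD : (1 - K * D).det ≠ 0)
    (hst : IsStablePair (toComplex E) (toComplex (A + B * (1 - K * D)⁻¹ * K * C)))
    (hspr : IsSPR (closedLoopTransfer
        (transferFunction (toComplex E) (toComplex A) (toComplex B) (toComplex C) (toComplex D))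
        (toComplex K) (toComplex L))) :
    ((bigA A B C D).det ≠ 0 ∧
      ∀ μ : ℂ, μ ≠ 0 → Module.End.HasEigenvalue
        (Matrix.toLin' (toComplex ((bigA A B C D)⁻¹ * bigE κ E))) μ → μ.re < 0) ∧
      zeroIndex ((bigA A B C D)⁻¹ * bigE κ E) ≤ 2 := by
  set E' := toComplex E with hE'
  set A' := toComplex A with hA'
  set B' := toComplex B with hB'
  set C' := toComplex C with hC'
  set D' := toComplex D with hD'
  set K' := toComplex K with hK'
  set L' := toComplex L with hL'
  have hAbig : toComplex (bigA A B C D) = bigA A' B' C' D' := toComplex_bigA _ _ _ _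
  have hKD' : (1 - K' * D').det ≠ 0 := by
    rw [hK', hD', ← toComplex_mul, ← toComplex_one (𝕜 := 𝕜), ← toComplex_sub]
    exact det_toComplex_ne_zero.2 hKD
  have hΨ : ∀ s : ℂ, 0 ≤ s.re → (closedLoopPencil E' A' B' C' D' K' s).det ≠ 0 := by
    intro s hs
    have h3 : toComplex (A + B * (1 - K * D)⁻¹ * K * C) =
        A' + B' * (1 - K' * D')⁻¹ * K' * C' := by
      simp [hA', hB', hK', hD', hC']
    rw [det_closedLoopPencil hKD']
    rw [h3, isStablePair_iff] at hst
    exact mul_ne_zero hKD' (hst s hs)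
  obtain ⟨ε, hε, hspr⟩ := hspr
  have hpos : ∀ s : ℂ, 0 ≤ s.re → ∀ v : κ → ℂ, v ≠ 0 →
      0 < (star v ⬝ᵥ closedLoopValue E' A' B' C' D' K' L' s *ᵥ v).re := fun s hs =>
    posDef_add_conjTranspose_iff.1
      (hspr s _ (by linarith) (tendsto_closedLoopTransfer hreg (hΨ s hs)))
  have hM : ∀ s : ℂ, 0 ≤ s.re → (closedLoopValue E' A' B' C' D' K' L' s).det ≠ 0 :=
    fun s hs => det_ne_zero_of_re_pos (hpos s hs)
  have hR : ∀ s : ℂ, 0 ≤ s.re → (systemPencil E' A' B' C' D' s).det ≠ 0 :=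
    fun s hs => det_systemPencil_ne_zero (hΨ s hs) (hM s hs)
  have hA0 : (bigA A' B' C' D').det ≠ 0 := by
    have := hR 0 le_rfl
    rw [systemPencil, zero_smul, zero_sub, det_neg] at this
    exact right_ne_zero_of_mul this
  have hA : (bigA A B C D).det ≠ 0 := by
    rw [← hAbig] at hA0; exact det_toComplex_ne_zero.1 hA0
  set S := (bigA A B C D)⁻¹ * bigE κ E with hS
  have hSbig : toComplex S = (bigA A' B' C' D')⁻¹ * bigE κ E' := by
    rw [hS, toComplex_mul, toComplex_inv, toComplex_bigA, toComplex_bigE]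
  have hS1 : ∀ s : ℂ, 0 ≤ s.re →
      (1 - s • ((bigA A' B' C' D')⁻¹ * bigE κ E')).det ≠ 0 := by
    intro s hs
    have := hR s hs
    rw [systemPencil_eq_mul hA0, det_neg, det_mul] at this
    exact right_ne_zero_of_mul (right_ne_zero_of_mul this)
  refine ⟨⟨hA, fun μ hμ hev => ?_⟩, ?_⟩
  · by_contra! hre
    obtain ⟨v, hv⟩ := hev.exists_hasEigenvector
    have hSv := hv.apply_eq_smul
    rw [toLin'_apply, hSbig] at hSv
    refine hS1 μ⁻¹ ?_ (exists_mulVec_eq_zero_iff.1 ⟨v, hv.2, ?_⟩)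
    · rw [Complex.inv_re]
      exact div_nonneg hre (Complex.normSq_nonneg _)
    · rw [sub_mulVec, one_mulVec, smul_mulVec, hSv, smul_smul, inv_mul_cancel₀ hμ, one_smul,
        sub_self]
  · obtain ⟨J, X, ν, hd⟩ := exists_isDrazin S
    set J' := toComplex J with hJ'
    set X' := toComplex X with hX'
    set S' := (bigA A' B' C' D')⁻¹ * bigE κ E' with hS'
    have hd' : IsDrazin S' J' X' ν := hSbig ▸ hd.toComplex
    have hTs : ∀ s : ℂ, 0 ≤ s.re →
        (X' - (1 - J') - s • (1 : Matrix (ι ⊕ κ) (ι ⊕ κ) ℂ)).det ≠ 0 := by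
      intro s hs h0
      refine hS1 s hs (hd'.det_one_sub_smul_eq_zero h0 ?_)
      rintro rfl
      norm_num at hs
    have hL : L'.det ≠ 0 := by
      have := hM 0 le_rfl
      rw [closedLoopValue, det_mul] at this
      exact left_ne_zero_of_mul this
    -- With `M` the closed-loop transfer function, `M p = L y` for `p = (N - K) y`, so that
    -- `pᴴ M p` has the same real part as `yᴴ Lᴴ (N - K) y`.
    have hNpos : ∀ s : ℂ, 0 ≤ s.re → ∀ y : κ → ℂ,
        0 ≤ (star y ⬝ᵥ (L'ᴴ * (inverseTransfer E' A' B' C' D' s - K')) *ᵥ y).re := by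
      intro s hs y
      have hML := closedLoopValue_mul (L := L') (hR s hs) (hΨ s hs)
      set p := (inverseTransfer E' A' B' C' D' s - K') *ᵥ y with hp
      have hMp : closedLoopValue E' A' B' C' D' K' L' s *ᵥ p = L' *ᵥ y := by
        rw [hp, mulVec_mulVec, hML]
      have h0 : 0 ≤ (star p ⬝ᵥ closedLoopValue E' A' B' C' D' K' L' s *ᵥ p).re := by
        rcases eq_or_ne p 0 with h | h
        · rw [h, mulVec_zero, dotProduct_zero, Complex.zero_re]
        · exact (hpos s hs p h).le
      rw [← mulVec_mulVec, ← hp, dotProduct_mulVec, ← star_mulVec, ← hMp]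
      rwa [← Complex.conj_re, ← Complex.star_def, ← star_dotProduct_star, star_star] at h0
    have hcoef : ∀ j, 2 ≤ j →
        (S' ^ j * (1 - J') * (bigA A' B' C' D')⁻¹).toBlocks₂₂ = 0 := by
      intro j hj
      rcases le_or_gt ν j with hνj | hjν
      · obtain ⟨r, rfl⟩ := Nat.exists_eq_add_of_le hνj
        rw [add_comm, pow_add, mul_assoc (S' ^ r), hd'.nilpotent, mul_zero, zero_mul]
        rfl
      set N : ℕ → Matrix κ κ ℂ :=
        fun i => (S' ^ i * (1 - J') * (bigA A' B' C' D')⁻¹).toBlocks₂₂ with hN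
      suffices h : L'ᴴ * N j = 0 by
        have hLu : IsUnit (L'ᴴ).det := by
          rw [det_conjTranspose]
          exact isUnit_iff_ne_zero.2 (star_ne_zero.2 hL)
        have h' := congrArg ((L'ᴴ)⁻¹ * ·) h
        simpa only [← mul_assoc, nonsing_inv_mul _ hLu, one_mul, mul_zero] using h'
      refine eq_zero_of_forall_star_dotProduct_mulVec fun y => ?_
      set p : Polynomial ℂ := ∑ i ∈ Finset.range ν,
        Polynomial.C (star y ⬝ᵥ (L'ᴴ * N i) *ᵥ y) * Polynomial.X ^ i with hp
      set g : Matrix (ι ⊕ κ) (ι ⊕ κ) ℂ → ℂ := fun M =>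
        star y ⬝ᵥ (L'ᴴ * ((M * X' * (bigA A' B' C' D')⁻¹).toBlocks₂₂ - K')) *ᵥ y with hg
      have hgc : Continuous g := by
        have h1 : Continuous fun M : Matrix (ι ⊕ κ) (ι ⊕ κ) ℂ =>
            (M * X' * (bigA A' B' C' D')⁻¹).toBlocks₂₂ :=
          (((continuous_id.matrix_mul continuous_const).matrix_mul
            continuous_const).matrix_submatrix Sum.inr Sum.inr)
        exact continuous_const.dotProduct
          ((continuous_const.matrix_mul (h1.sub continuous_const)).matrix_mulVec continuous_const)
      have hlim := (hgc.tendsto 0).comp (tendsto_inv_sub_smul_one_cobounded (X' - (1 - J')))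
      have hdeg : p.natDegree ≤ 1 := by
        refine natDegree_le_one_of_re_nonneg hlim fun s hs => ?_
        have h1 := hNpos s hs y
        have h3 := (inverseTransfer_eq (s := s) hA0 hd' (hTs s hs)).2
        convert h1 using 2
        rw [h3, hp, Polynomial.eval_finsetSum]
        simp only [Function.comp_apply, hg]
        rw [add_sub_assoc, mul_add, add_mulVec, dotProduct_add, Finset.mul_sum, sum_mulVec,
          dotProduct_sum]
        congr 1
        refine Finset.sum_congr rfl fun i _ => ?_
        rw [Polynomial.eval_mul, Polynomial.eval_C, Polynomial.eval_pow, Polynomial.eval_X,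
          mul_smul_comm, smul_mulVec, dotProduct_smul, smul_eq_mul, mul_comm]
      have hj0 : p.coeff j = 0 := Polynomial.coeff_eq_zero_of_natDegree_lt (by omega)
      rw [hp, Polynomial.finsetSum_coeff] at hj0
      simpa [Polynomial.coeff_C_mul, Polynomial.coeff_X_pow, hjν] using hj0
    have hcoef' : ∀ j, 2 ≤ j → (S ^ j * (1 - J) * (bigA A B C D)⁻¹).toBlocks₂₂ = 0 := by
      intro j hj
      apply toComplex_injective
      rw [toComplex_toBlocks₂₂, toComplex_mul, toComplex_mul, toComplex_pow, toComplex_sub,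
        toComplex_one, toComplex_inv, hAbig, hSbig, toComplex_zero]
      exact hcoef j hj
    rw [hd.zeroIndex_le_iff]
    have hdesc : ∀ r, S ^ (2 + r) * (1 - J) = 0 → S ^ 2 * (1 - J) = 0 := by
      intro r
      induction r with
      | zero => exact id
      | succ r ih =>
        intro h
        have e : 2 + r = r + 1 + 1 := by ring
        refine ih ?_
        rw [e]
        refine pow_mul_eq_zero_descent hEB hEC hA hd.comm ?_ (hcoef' _ (by omega))
        rw [← hS, ← h]
        congr 2
        ring
    refine hdesc ν ?_
    rw [pow_add, mul_assoc, hd.nilpotent, mul_zero]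

end Main
end DescriptorSystem

open DescriptorSystem in
theorem theorem1 {𝕜 : Type*} [RCLike 𝕜] {n m : ℕ}
    (E A : Matrix (Fin n) (Fin n) 𝕜) (B : Matrix (Fin n) (Fin m) 𝕜)
    (C : Matrix (Fin m) (Fin n) 𝕜) (D : Matrix (Fin m) (Fin m) 𝕜)
    (hreg : IsRegularPair (toComplex E) (toComplex A))
    (hEB : HasMaxRank (Matrix.fromCols E B))
    (hEC : HasMaxRank (Matrix.fromRows E C)) :
    (∃ K L : Matrix (Fin m) (Fin m) 𝕜,
        (1 - K * D).det ≠ 0 ∧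
        IsStablePair (toComplex E) (toComplex (A + B * (1 - K * D)⁻¹ * K * C)) ∧
        IsSPR (closedLoopTransfer
          (transferFunction (toComplex E) (toComplex A) (toComplex B) (toComplex C) (toComplex D))
          (toComplex K) (toComplex L))) ↔
      (((bigA A B C D).det ≠ 0 ∧
          ∀ μ : ℂ, μ ≠ 0 →
            Module.End.HasEigenvalue
              (Matrix.toLin' (toComplex ((bigA A B C D)⁻¹ * bigE (Fin m) E))) μ →
            μ.re < 0) ∧
        zeroIndex ((bigA A B C D)⁻¹ * bigE (Fin m) E) ≤ 2) := by
  constructor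
  · rintro ⟨K, L, hKD, hst, hspr⟩
    exact conditions_of_feedback hreg hEB hEC hKD hst hspr
  · rintro ⟨⟨hA, hev⟩, hidx⟩
    exact exists_feedback hreg hA hev hidx
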